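/- Let $T>0$, let $\mathcal S\subset\mathbb R^3$ be a connected compact set such that $\Omega=\mathbb R^3\setminus\mathcal S$ is a connected open set of class $C^\infty$, and let $\nu$ be the unit normal to $\partial\Omega$ pointing out of $\Omega$. Let $m\in\mathbb N$, $\chi_1,\dots,\chi_m\in C^\infty(\partial\Omega)$, let $w_1,\dots,w_m$ be real functions of time (the controls), and let $l,r:[0,T]\to\mathbb R^3$ be continuous (the linear and angular velocity of the rigid body, in the frame linked to the body). Let $(v,q)$ be a classical solution of $$\partial_t v+((v-l-r\times y)\cdot\nabla)v+r\times v+\nabla q=0,\qquad \operatorname{div} v=0\qquad\text{in }(0,T)\times\Omega,$$ $$v\cdot\nu=(l+r\times y)\cdot\nu+\sum_{j=1}^m w_j(t)\chi_j(y)\quad\text{on }(0,T)\times\partial\Omega,\qquad \lim_{|y|\to\infty}v(t,y)=0\quad\text{for } t\in(0,T).$$ Here "classical" means: $v$ is bounded on $[0,T]\times\Omega$; $v$ and its spatial Jacobian $D_yv$ exist and are continuous on $[0,T]\times\overline\Omega$ and are of class $C^1$ in $(t,y)$ on $(0,T)\times\Omega$; and $q(t,\cdot)$ is differentiable in $\Omega$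 for each $t\in(0,T)$. Let $\zeta=\operatorname{curl}v$ be the vorticity, defined on $[0,T]\times\overline\Omega$. Assume that $\zeta(0,\cdot)=0$ in $\Omega$, and that for all $t\in(0,T)$ $$\zeta(t,y)=0\quad\text{whenever } y\in\bigcup_{1\le j\le m}\operatorname{supp}\chi_j\ \text{ and }\ \sum_{j=1}^m w_j(t)\chi_j(y)\le 0,$$ where $\operatorname{supp}\chi_j$ is the closure of $\{y\in\partial\Omega:\chi_j(y)\ne0\}$. Then $\zeta=\operatorname{curl}v\equiv0$ in $[0,T]\times\Omega$. -/

import Mathlib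

open Set Filter Topology
open scoped ContDiff

/-- Euclidean three-space. -/
abbrev E3 : Type := EuclideanSpace ℝ (Fin 3)

namespace UnderwaterVehicle

noncomputable section

/-- The `i`-th vector of the canonical basis of `ℝ³`. -/
def e (i : Fin 3) : E3 := EuclideanSpace.single i (1 : ℝ)

/-- The cross product `x × y` in `ℝ³`. -/
def cross (x y : E3) : E3 :=
  !₂[x 1 * y 2 - x 2 * y 1, x 2 * y 0 - x 0 * y 2, x 0 * y 1 - x 1 * y 0]

/-- The divergence `∑ ∂ᵢ vᵢ`, as a function of the Jacobian `A = Dv(y)`, so `(A (e i)) j = ∂ᵢ vⱼ`. -/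
def divOf (A : E3 →L[ℝ] E3) : ℝ := ∑ i, (A (e i)) i

/-- The curl `∇ × v`, as a function of the Jacobian `A = Dv(y)`, so `(A (e i)) j = ∂ᵢ vⱼ`. -/
def curlOf (A : E3 →L[ℝ] E3) : E3 :=
  !₂[(A (e 1)) 2 - (A (e 2)) 1, (A (e 2)) 0 - (A (e 0)) 2, (A (e 0)) 1 - (A (e 1)) 0]

/-- `ρ` is a smooth defining function of `Ω` in the open set `U`:
`Ω ∩ U = {y ∈ U | ρ y < 0}`, and `∇ρ` does not vanish in `U`. -/
structure IsDefiningFunction (Ω U : Set E3) (ρ : E3 → ℝ) : Prop where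
  isOpen : IsOpen U
  smooth : ContDiffOn ℝ ∞ ρ U
  gradient_ne_zero : ∀ y ∈ U, gradient ρ y ≠ 0
  mem_iff : ∀ y ∈ U, y ∈ Ω ↔ ρ y < 0

/-- An open set of class `C^∞`: near each of its boundary points it has a smooth defining
function (it lies locally on one side of its smooth boundary). -/
def IsSmoothDomain (Ω : Set E3) : Prop :=
  IsOpen Ω ∧ ∀ x ∈ frontier Ω, ∃ U ρ, x ∈ U ∧ IsDefiningFunction Ω U ρ

/-- `n` is the outward unit normal to `∂Ω` at the boundary point `x`, i.e. `n = ∇ρ(x) / |∇ρ(x)|`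
for a defining function `ρ` of `Ω` near `x`. -/
def IsOutwardNormal (Ω : Set E3) (x n : E3) : Prop :=
  x ∈ frontier Ω ∧ ∃ U ρ, x ∈ U ∧ IsDefiningFunction Ω U ρ ∧
    n = ‖gradient ρ x‖⁻¹ • gradient ρ x

/-- The support of a function defined on `∂Ω`; values of `χ` off `∂Ω` are irrelevant. -/
def bdrySupport (Ω : Set E3) (χ : E3 → ℝ) : Set E3 := closure {y ∈ frontier Ω | χ y ≠ 0}

/-- The spatial Jacobian `D_y v(t, y)` for `y` in the closure of `Ω`. For `y ∈ Ω` this is the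
usual derivative; for `y ∈ ∂Ω` it is the derivative of `v t` up to the boundary. -/
def jac (Ω : Set E3) (v : ℝ → E3 → E3) (t : ℝ) (y : E3) : E3 →L[ℝ] E3 :=
  fderivWithin ℝ (v t) (closure Ω) y

/-- The vorticity `ζ(t, y) = curl v(t, y)`, for `y` in the closure of `Ω`. -/
def vorticity (Ω : Set E3) (v : ℝ → E3 → E3) (t : ℝ) (y : E3) : E3 := curlOf (jac Ω v t y)

/-- Regularity of a classical velocity field on `[0,T] × Ω`: the field is bounded, `v` and `D_y v`
are continuous up to the boundary, and both are `C^1` in `(t, y)` in the interior. -/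
structure IsClassicalField (T : ℝ) (Ω : Set E3) (v : ℝ → E3 → E3) : Prop where
  bounded : ∃ C : ℝ, ∀ t ∈ Icc 0 T, ∀ y ∈ Ω, ‖v t y‖ ≤ C
  continuousOn : ContinuousOn (fun p : ℝ × E3 => v p.1 p.2) (Icc 0 T ×ˢ closure Ω)
  differentiableOn : ∀ t ∈ Icc 0 T, DifferentiableOn ℝ (v t) (closure Ω)
  jac_continuousOn : ContinuousOn (fun p : ℝ × E3 => jac Ω v p.1 p.2) (Icc 0 T ×ˢ closure Ω)
  contDiffOn : ContDiffOn ℝ 1 (fun p : ℝ × E3 => v p.1 p.2) (Ioo 0 T ×ˢ Ω)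
  jac_contDiffOn : ContDiffOn ℝ 1 (fun p : ℝ × E3 => jac Ω v p.1 p.2) (Ioo 0 T ×ˢ Ω)

/-- `(v, q)` solves, classically on `(0,T) × Ω`, the incompressible Euler equations in the frame of
a rigid body moving with linear velocity `l` and angular velocity `r` (both expressed in that
frame), with the flow `∑ⱼ wⱼ(t) χⱼ(y)` through the boundary of the body as control. -/
structure IsFluidSolution (T : ℝ) (Ω : Set E3) {m : ℕ} (χ : Fin m → E3 → ℝ) (w : Fin m → ℝ → ℝ)
    (l r : ℝ → E3) (v : ℝ → E3 → E3) (q : ℝ → E3 → ℝ) : Prop where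
  regular : IsClassicalField T Ω v
  pressure_differentiableOn : ∀ t ∈ Ioo 0 T, DifferentiableOn ℝ (q t) Ω
  momentum : ∀ t ∈ Ioo 0 T, ∀ y ∈ Ω,
    deriv (fun s => v s y) t + jac Ω v t y (v t y - l t - cross (r t) y)
      + cross (r t) (v t y) + gradient (q t) y = 0
  div_free : ∀ t ∈ Ioo 0 T, ∀ y ∈ Ω, divOf (jac Ω v t y) = 0
  boundary : ∀ t ∈ Ioo 0 T, ∀ y ∈ frontier Ω, ∀ n, IsOutwardNormal Ω y n →
    inner ℝ (v t y) n = inner ℝ (l t + cross (r t) y) n + ∑ j, w j t * χ j y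
  at_infinity : ∀ t ∈ Ioo 0 T, Tendsto (v t) (Bornology.cobounded E3 ⊓ 𝓟 Ω) (𝓝 0)

end

end UnderwaterVehicle

/-! Write u = v - l - r × y. Taking the curl of the momentum equation removes the pressure and gives
∂ₜζ + (u·∇)ζ = (ζ·∇)v - r × ζ (`vorticity_equation`). Vorticity is carried by u and stretched at a
bounded rate on compact sets, so it can only come from the initial data or through the part of ∂Ω
where fluid enters.

The argument is a maximum principle and needs no flow map. With θ = R - exp(Ct)(1 + |y|²), which
does not increase along u, the function F = exp(-Kt)|ζ|²θ satisfies ∂ₜF + u·∇F ≤ -F wherever θ ≥ 0,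
for K large. If ζ is nonzero somewhere, R can be chosen so that F has a positive maximum over the
past, at some (t₀, x₀) in a compact set. Zero initial vorticity forces t₀ > 0. If x₀ ∈ ∂Ω, the
inflow condition forces u·ν ≥ 0 on ∂Ω near (t₀, x₀) (`flux_nonneg`).

Then a defining function ρ satisfies u·∇ρ ≥ Cρ in Ω near x₀ (`IsDefiningFunction.lower_bound`), so
exp(Ct)/(-ρ) does not decrease along u and blows up at ∂Ω. Subtracting a small multiple of it, with
a quadratic penalty, moves the maximum inside Ω, where differentiating backwards along (1, u)
contradicts the differential inequality (`no_positive_max`). -/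

/-! ### The local maximum principle -/

theorem HasDerivAt.nonneg_of_eventually_le_left {f : ℝ → ℝ} {D a : ℝ} (hf : HasDerivAt f D a)
    (hm : ∀ᶠ s in 𝓝[≤] a, f s ≤ f a) : 0 ≤ D := by
  have h1 : (-1 : ℝ) ∈ posTangentConeAt (Iic a) a := by
    apply mem_posTangentConeAt_of_segment_subset
    rw [segment_symm, segment_eq_Icc (by linarith)]
    exact fun x hx => hx.2
  have h2 := IsLocalMaxOn.hasFDerivWithinAt_nonpos (f := f) (s := Iic a) hm
    hf.hasFDerivAt.hasFDerivWithinAt h1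
  simp at h2
  linarith

section Barrier

variable {E : Type*} [NormedAddCommGroup E] [InnerProductSpace ℝ E]

/-- Along the direction `(1, u)`, the derivative of `F` corrected by a quadratic penalization and
by the barrier `exp (C t) / b`. -/
theorem hasDerivAt_penalized {F : ℝ × E → ℝ} {F' : ℝ × E →L[ℝ] ℝ} {b : E → ℝ} {b' : E →L[ℝ] ℝ}
    {t : ℝ} {y : E} (u x₀ : E) (t₀ δ ε C : ℝ) (hF : HasFDerivAt F F' (t, y))
    (hb : HasFDerivAt b b' y) (hby : b y ≠ 0) :
    HasDerivAt (fun s : ℝ => F (s, y + (s - t) • u)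
        - δ * (‖y + (s - t) • u - x₀‖ ^ 2 + (s - t₀) ^ 2)
        - ε * (Real.exp (C * s) / b (y + (s - t) • u)))
      (F' (1, u) - δ * (2 * inner ℝ (y - x₀) u + 2 * (t - t₀))
        - ε * ((Real.exp (C * t) * C * b y - Real.exp (C * t) * b' u) / b y ^ 2)) t := by
  have hc : HasDerivAt (fun s : ℝ => y + (s - t) • u) u t := by
    simpa using (((hasDerivAt_id t).sub_const t).smul_const u).const_add y
  have hct : y + (t - t) • u = y := by simp
  have h1 : HasDerivAt (fun s : ℝ => F (s, y + (s - t) • u)) (F' (1, u)) t := by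
    have := HasFDerivAt.comp_hasDerivAt (f := fun s : ℝ => (s, y + (s - t) • u)) t
      (by rw [hct]; exact hF) ((hasDerivAt_id t).prodMk hc)
    exact this
  have h2 : HasDerivAt (fun s : ℝ => ‖y + (s - t) • u - x₀‖ ^ 2) (2 * inner ℝ (y - x₀) u) t := by
    have := (hc.sub_const x₀).norm_sq
    rwa [hct] at this
  have h3 : HasDerivAt (fun s : ℝ => (s - t₀) ^ 2) (2 * (t - t₀)) t := by
    simpa using ((hasDerivAt_id t).sub_const t₀).fun_pow 2
  have h4 : HasDerivAt (fun s : ℝ => Real.exp (C * s)) (Real.exp (C * t) * C) t := by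
    simpa using ((hasDerivAt_id t).const_mul C).exp
  have h5 : HasDerivAt (fun s : ℝ => b (y + (s - t) • u)) (b' u) t :=
    HasFDerivAt.comp_hasDerivAt (f := fun s : ℝ => y + (s - t) • u) t
      (by rw [hct]; exact hb) hc
  have h6 := h4.div h5 (by rw [hct]; exact hby)
  rw [hct] at h6
  exact (h1.sub ((h2.add h3).const_mul δ)).sub (h6.const_mul ε)

/-- A maximum principle: a function with `∂ₜF + u·∇F ≤ -F` in `Ω` has no positive maximum over
the past at a point `(t₀, x₀)` near which `Ω` admits a barrier `b` with `u·∇b ≤ C b`. -/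
theorem no_positive_max [ProperSpace E] {Ω : Set E} {x₀ : E} (hx₀ : x₀ ∈ closure Ω)
    {t₀ h C B : ℝ} (hh : 0 < h) {b : E → ℝ} {b' : E → E →L[ℝ] ℝ}
    (hb : ContinuousOn b (Metric.closedBall x₀ h))
    (hbΩ : ∀ y ∈ Metric.closedBall x₀ h, y ∈ Ω ↔ 0 < b y)
    (hb' : ∀ y ∈ Metric.closedBall x₀ h, y ∈ Ω → HasFDerivAt b (b' y) y)
    {u : ℝ → E → E}
    (hu : ∀ t ∈ Icc (t₀ - h) t₀, ∀ y ∈ Metric.closedBall x₀ h, y ∈ Ω → ‖u t y‖ ≤ B)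
    (hbu : ∀ t ∈ Icc (t₀ - h) t₀, ∀ y ∈ Metric.closedBall x₀ h, y ∈ Ω →
      b' y (u t y) ≤ C * b y)
    {F : ℝ × E → ℝ}
    (hF : ContinuousOn F (Icc (t₀ - h) t₀ ×ˢ (Metric.closedBall x₀ h ∩ closure Ω)))
    (hF0 : 0 < F (t₀, x₀))
    (hmax : ∀ t ∈ Icc (t₀ - h) t₀, ∀ y ∈ Metric.closedBall x₀ h, y ∈ closure Ω →
      F (t, y) ≤ F (t₀, x₀))
    (hF' : ∀ t ∈ Icc (t₀ - h) t₀, ∀ y ∈ Metric.closedBall x₀ h, y ∈ Ω →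
      ∃ F' : ℝ × E →L[ℝ] ℝ, HasFDerivAt F F' (t, y) ∧ F' (1, u t y) ≤ -F (t, y)) : False := by
  set m := F (t₀, x₀) with hm
  have ht₀ : t₀ ∈ Icc (t₀ - h) t₀ := ⟨by linarith, le_rfl⟩
  have hne : (𝓝[Ω] x₀).NeBot := mem_closure_iff_nhdsWithin_neBot.1 hx₀
  have hball : ∀ᶠ y in 𝓝[Ω] x₀, y ∈ Metric.ball x₀ h :=
    mem_nhdsWithin_of_mem_nhds (Metric.ball_mem_nhds _ hh)
  have hB : 0 ≤ B := by
    obtain ⟨y, hy, hyΩ⟩ := (hball.and self_mem_nhdsWithin).exists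
    exact (norm_nonneg _).trans (hu t₀ ht₀ y (Metric.ball_subset_closedBall hy) hyΩ)
  -- `δ * h ^ 2` is the penalty at the edge of the cylinder, and `δ * (2 * h * B + 2 * h)` bounds
  -- the derivative of the penalty along `(1, u)`. Their sum must stay below `m` for the final
  -- contradiction.
  obtain ⟨δ, hδ, hδm⟩ : ∃ δ > 0, δ * (h ^ 2 + 2 * h * B + 2 * h) < m := by
    have : 0 < h ^ 2 + 2 * h * B + 2 * h := by positivity
    refine ⟨m / 2 / (h ^ 2 + 2 * h * B + 2 * h), by positivity, ?_⟩
    rw [div_mul_cancel₀ _ this.ne']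
    linarith
  -- a point of `Ω` where the penalized function is almost maximal
  obtain ⟨y₁, hy₁, hy₁Ω, hy₁F⟩ : ∃ y₁ ∈ Metric.ball x₀ h, y₁ ∈ Ω ∧
      m - δ * h ^ 2 < F (t₀, y₁) - δ * ‖y₁ - x₀‖ ^ 2 := by
    have h1 : Tendsto (fun y => F (t₀, y)) (𝓝[Ω] x₀) (𝓝 m) := by
      have hc := hF (t₀, x₀) ⟨ht₀, Metric.mem_closedBall_self hh.le, hx₀⟩
      refine hc.tendsto.comp (tendsto_nhdsWithin_iff.2 ⟨?_, ?_⟩)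
      · exact ((Continuous.prodMk_right t₀).tendsto x₀).mono_left nhdsWithin_le_nhds
      · filter_upwards [hball, self_mem_nhdsWithin] with y hy hyΩ
        exact ⟨ht₀, Metric.ball_subset_closedBall hy, subset_closure hyΩ⟩
    have h2 : Tendsto (fun y => δ * ‖y - x₀‖ ^ 2) (𝓝[Ω] x₀) (𝓝 0) := by
      have : Continuous fun y => δ * ‖y - x₀‖ ^ 2 := by fun_prop
      simpa using (this.tendsto x₀).mono_left (nhdsWithin_le_nhds (s := Ω))
    have h3 := (h1.sub h2).eventually (lt_mem_nhds (a := m - δ * h ^ 2) (by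
      have : 0 < δ * h ^ 2 := by positivity
      linarith))
    obtain ⟨y, ⟨hy, hyΩ⟩, hy3⟩ := ((hball.and self_mem_nhdsWithin).and h3).exists
    exact ⟨y, hy, hyΩ, hy3⟩
  have hb₁ : 0 < b y₁ := (hbΩ y₁ (Metric.ball_subset_closedBall hy₁)).1 hy₁Ω
  have hmδ : 0 < m - δ * h ^ 2 := by
    have : 0 ≤ δ * (2 * h * B + 2 * h) := by positivity
    nlinarith
  -- The barrier may be singular at `x₀`, so the comparison point is `y₁`; `ε` spends only part of
  -- the slack available there.
  obtain ⟨ε, hε, hεm⟩ : ∃ ε > 0, ε * (Real.exp (C * t₀) / b y₁)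
      < F (t₀, y₁) - δ * ‖y₁ - x₀‖ ^ 2 - (m - δ * h ^ 2) := by
    have : 0 < Real.exp (C * t₀) / b y₁ := by positivity
    refine ⟨(F (t₀, y₁) - δ * ‖y₁ - x₀‖ ^ 2 - (m - δ * h ^ 2)) / 2 /
      (Real.exp (C * t₀) / b y₁), div_pos (by linarith) this, ?_⟩
    rw [div_mul_cancel₀ _ this.ne']
    linarith
  -- below the level `κ`, the barrier dominates
  obtain ⟨c, hc, hct⟩ : ∃ c > 0, ∀ t ∈ Icc (t₀ - h) t₀, c ≤ Real.exp (C * t) := by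
    obtain ⟨s, -, hs⟩ := isCompact_Icc.exists_isMinOn ⟨t₀, ht₀⟩
      (f := fun t => Real.exp (C * t)) (by fun_prop)
    exact ⟨_, Real.exp_pos (C * s), fun t ht => hs ht⟩
  obtain ⟨κ, hκ, hκ₁, hκm⟩ : ∃ κ > 0, κ ≤ b y₁ ∧ m ≤ ε * (c / κ) := by
    have hp : 0 < ε * c / m := by positivity
    refine ⟨min (b y₁) (ε * c / m), lt_min hb₁ hp, min_le_left _ _, ?_⟩
    have := min_le_right (b y₁) (ε * c / m)
    have hpos : 0 < min (b y₁) (ε * c / m) := lt_min hb₁ hp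
    rw [← mul_div_assoc, le_div_iff₀ hpos]
    calc m * min (b y₁) (ε * c / m) ≤ m * (ε * c / m) := by gcongr
      _ = ε * c := by field_simp
  set M : Set (ℝ × E) := Icc (t₀ - h) t₀ ×ˢ (Metric.closedBall x₀ h ∩ b ⁻¹' Ici κ) with hMdef
  have hMc : IsCompact M := isCompact_Icc.prod
    ((isCompact_closedBall x₀ h).of_isClosed_subset
      (hb.preimage_isClosed_of_isClosed Metric.isClosed_closedBall isClosed_Ici)
      inter_subset_left)
  have hMb : ∀ p ∈ M, 0 < b p.2 := fun p hp => hκ.trans_le hp.2.2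
  have hMΩ : ∀ p ∈ M, p.2 ∈ Ω := fun p hp => (hbΩ _ hp.2.1).2 (hMb p hp)
  set G : ℝ × E → ℝ := fun p => F p - δ * (‖p.2 - x₀‖ ^ 2 + (p.1 - t₀) ^ 2)
    - ε * (Real.exp (C * p.1) / b p.2) with hG
  have hGc : ContinuousOn G M := by
    have h1 : ContinuousOn F M := hF.mono fun p hp => ⟨hp.1, hp.2.1, subset_closure (hMΩ p hp)⟩
    have h2 : ContinuousOn (fun p : ℝ × E => b p.2) M :=
      hb.comp continuousOn_snd fun p hp => hp.2.1
    have h3 : ContinuousOn (fun p : ℝ × E => Real.exp (C * p.1) / b p.2) M :=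
      ContinuousOn.div (by fun_prop) h2 fun p hp => (hMb p hp).ne'
    have h4 : ContinuousOn (fun p : ℝ × E => δ * (‖p.2 - x₀‖ ^ 2 + (p.1 - t₀) ^ 2)) M := by
      fun_prop
    exact (h1.sub h4).sub (h3.const_smul ε)
  have hp₁ : (t₀, y₁) ∈ M := ⟨ht₀, Metric.ball_subset_closedBall hy₁, hκ₁⟩
  obtain ⟨⟨t, y⟩, hp, hpmax⟩ := hMc.exists_isMaxOn ⟨_, hp₁⟩ hGc
  have hG₁ : m - δ * h ^ 2 < G (t, y) := by
    refine lt_of_lt_of_le ?_ (hpmax hp₁)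
    simp only [hG, sub_self]
    nlinarith
  have hyΩ := hMΩ _ hp
  have hby := hMb _ hp
  obtain ⟨ht, hyb, hyκ⟩ := hp
  simp only at ht hyb hyΩ hby
  have hbar : 0 < ε * (Real.exp (C * t) / b y) := by positivity
  have hFm := hmax t ht y hyb (subset_closure hyΩ)
  have hpen : ‖y - x₀‖ ^ 2 + (t - t₀) ^ 2 < h ^ 2 := by
    by_contra! hcon
    have : δ * h ^ 2 ≤ δ * (‖y - x₀‖ ^ 2 + (t - t₀) ^ 2) := by gcongr
    simp only [hG] at hG₁
    linarith
  have hpen0 : 0 ≤ δ * (‖y - x₀‖ ^ 2 + (t - t₀) ^ 2) := by positivity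
  have hyh : ‖y - x₀‖ < h := lt_of_pow_lt_pow_left₀ 2 hh.le (by nlinarith [sq_nonneg (t - t₀)])
  have hth : t₀ - h < t := by
    by_contra! hcon
    nlinarith [sq_nonneg ‖y - x₀‖]
  have hκy : κ < b y := by
    by_contra! hcon
    have h1 : c / κ ≤ Real.exp (C * t) / b y :=
      div_le_div₀ (Real.exp_pos _).le (hct t ht) hby hcon
    have : ε * (c / κ) ≤ ε * (Real.exp (C * t) / b y) := by gcongr
    simp only [hG] at hG₁
    linarith
  obtain ⟨F', hFd, hFle⟩ := hF' t ht y hyb hyΩ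
  have hder := hasDerivAt_penalized (u t y) x₀ t₀ δ ε C hFd (hb' y hyb hyΩ) hby.ne'
  have hcurve : ContinuousAt (fun s : ℝ => y + (s - t) • u t y) t := by fun_prop
  -- The maximum may sit at the final time `t₀`, so only `s ≤ t` is compared. The other constraints
  -- defining `M` are strict at `(t, y)`, hence the backward curve stays in `M`.
  have hnn := hder.nonneg_of_eventually_le_left (by
    have e1 : ∀ᶠ s in 𝓝 t, y + (s - t) • u t y ∈ Metric.ball x₀ h :=
      hcurve.eventually (Metric.isOpen_ball.mem_nhds (by simpa [dist_eq_norm] using hyh))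
    have hbc : ContinuousAt b y := (hb' y hyb hyΩ).continuousAt
    have e2 : ∀ᶠ s in 𝓝 t, κ < b (y + (s - t) • u t y) := by
      have : ContinuousAt (fun s : ℝ => b (y + (s - t) • u t y)) t :=
        ContinuousAt.comp (f := fun s : ℝ => y + (s - t) • u t y) (by simpa using hbc) hcurve
      exact this.eventually (lt_mem_nhds (by simpa using hκy))
    have e3 : ∀ᶠ s in 𝓝 t, t₀ - h < s := lt_mem_nhds hth
    filter_upwards [mem_nhdsWithin_of_mem_nhds e1, mem_nhdsWithin_of_mem_nhds e2,
      mem_nhdsWithin_of_mem_nhds e3, self_mem_nhdsWithin] with s h1 h2 h3 h4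
    have := hpmax (show (s, y + (s - t) • u t y) ∈ M from
      ⟨⟨h3.le, (mem_Iic.1 h4).trans ht.2⟩, Metric.ball_subset_closedBall h1, h2.le⟩)
    simpa [hG] using this)
  have hbt := hbu t ht y hyb hyΩ
  have hlast :
      0 ≤ ε * ((Real.exp (C * t) * C * b y - Real.exp (C * t) * b' y (u t y)) / b y ^ 2) := by
    have : 0 ≤ Real.exp (C * t) * (C * b y - b' y (u t y)) :=
      mul_nonneg (Real.exp_pos _).le (by linarith)
    have h2 : 0 ≤ Real.exp (C * t) * C * b y - Real.exp (C * t) * b' y (u t y) := by linarith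
    positivity
  have hinner : -(h * B) ≤ inner ℝ (y - x₀) (u t y) := by
    have h1 := abs_le.1 (abs_real_inner_le_norm (y - x₀) (u t y))
    have h2 : ‖y - x₀‖ * ‖u t y‖ ≤ h * B :=
      mul_le_mul hyh.le (hu t ht y hyb hyΩ) (norm_nonneg _) hh.le
    linarith [h1.1]
  have hδ2 : -(δ * (2 * h * B + 2 * h)) ≤ δ * (2 * inner ℝ (y - x₀) (u t y) + 2 * (t - t₀)) := by
    rw [← mul_neg]
    gcongr
    linarith
  have hGF : G (t, y) ≤ F (t, y) := by
    simp only [hG]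
    linarith
  linarith

end Barrier

/-! ### The barrier at the boundary -/

/-- Suppose that `φ` starts from a negative value and increases at least at rate `c`. If `γ`
increases at most at rate `C₁` and is nonnegative at the first zero of `φ`, then `γ 0` is bounded
below by a multiple of `φ 0`. -/
theorem lower_bound_of_nonneg_at_zero {φ φ' γ γ' : ℝ → ℝ} {c C₁ a : ℝ} (hc : 0 < c) (hC₁ : 0 ≤ C₁)
    (ha : a = -φ 0 / c) (hφ0 : φ 0 < 0)
    (hφ : ∀ s ∈ Icc 0 a, HasDerivAt φ (φ' s) s) (hφ' : ∀ s ∈ Icc 0 a, c ≤ φ' s)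
    (hγc : ∀ s ∈ Ioc 0 a, φ s = 0 → (∀ s' ∈ Ico 0 s, φ s' < 0) → ContinuousOn γ (Icc 0 s))
    (hγ : ∀ s ∈ Icc 0 a, φ s < 0 → HasDerivAt γ (γ' s) s)
    (hγ' : ∀ s ∈ Icc 0 a, φ s < 0 → γ' s ≤ C₁)
    (hzero : ∀ s ∈ Ioc 0 a, φ s = 0 → (∀ s' ∈ Ico 0 s, φ s' < 0) → 0 ≤ γ s) :
    C₁ / c * φ 0 ≤ γ 0 := by
  have hapos : 0 < a := by rw [ha]; exact div_pos (by linarith) hc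
  have hφc : ContinuousOn φ (Icc 0 a) := fun s hs => (hφ s hs).continuousAt.continuousWithinAt
  have hmvt : ∀ s₁ ∈ Icc 0 a, ∀ s₂ ∈ Icc 0 a, s₁ < s₂ → c * (s₂ - s₁) ≤ φ s₂ - φ s₁ := by
    intro s₁ h₁ s₂ h₂ h12
    have hsub : Icc s₁ s₂ ⊆ Icc 0 a := Icc_subset_Icc h₁.1 h₂.2
    obtain ⟨ξ, hξ, he⟩ := exists_hasDerivAt_eq_slope φ φ' h12 (hφc.mono hsub)
      fun x hx => hφ x (hsub (Ioo_subset_Icc_self hx))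
    have := hφ' ξ (hsub (Ioo_subset_Icc_self hξ))
    rw [he, le_div_iff₀ (by linarith)] at this
    exact this
  have hφa : 0 ≤ φ a := by
    have := hmvt 0 ⟨le_rfl, hapos.le⟩ a ⟨hapos.le, le_rfl⟩ hapos
    have h2 : c * a = -φ 0 := by rw [ha]; field_simp
    nlinarith
  -- `a` is the latest possible hitting time at growth rate `c`. As `φ` is strictly increasing, this
  -- zero is the first; `γ` gains at most `C₁ * s ≤ C₁ * a` before it.
  obtain ⟨s, hs, hs0⟩ := intermediate_value_Icc hapos.le hφc ⟨hφ0.le, hφa⟩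
  have hspos : 0 < s := lt_of_le_of_ne hs.1 (by rintro rfl; linarith)
  have hneg : ∀ s' ∈ Ico 0 s, φ s' < 0 := by
    intro s' hs'
    have := hmvt s' ⟨hs'.1, hs'.2.le.trans hs.2⟩ s hs hs'.2
    have : 0 < c * (s - s') := mul_pos hc (by linarith [hs'.2])
    linarith
  have hs' : s ∈ Ioc 0 a := ⟨hspos, hs.2⟩
  obtain ⟨ξ, hξ, he⟩ := exists_hasDerivAt_eq_slope γ γ' hspos (hγc s hs' hs0 hneg)
    fun x hx => hγ x ⟨hx.1.le, hx.2.le.trans hs.2⟩ (hneg x ⟨hx.1.le, hx.2⟩)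
  have h1 := hγ' ξ ⟨hξ.1.le, hξ.2.le.trans hs.2⟩ (hneg ξ ⟨hξ.1.le, hξ.2⟩)
  rw [he, sub_zero, div_le_iff₀ hspos] at h1
  have h2 := hzero s hs' hs0 hneg
  have h3 : C₁ * s ≤ C₁ * a := mul_le_mul_of_nonneg_left hs.2 hC₁
  have h4 : C₁ * a = -(C₁ / c * φ 0) := by rw [ha]; ring
  linarith

namespace UnderwaterVehicle

variable {Ω U : Set E3} {ρ : E3 → ℝ}

theorem IsDefiningFunction.contDiffAt (hρ : IsDefiningFunction Ω U ρ) {y : E3} (hy : y ∈ U) :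
    ContDiffAt ℝ ∞ ρ y :=
  hρ.smooth.contDiffAt (hρ.isOpen.mem_nhds hy)

theorem IsDefiningFunction.differentiableAt (hρ : IsDefiningFunction Ω U ρ) {y : E3}
    (hy : y ∈ U) : DifferentiableAt ℝ ρ y :=
  (hρ.contDiffAt hy).differentiableAt (by simp)

theorem IsDefiningFunction.eq_zero (hΩ : IsOpen Ω) (hρ : IsDefiningFunction Ω U ρ) {y : E3}
    (hy : y ∈ U) (hyf : y ∈ frontier Ω) : ρ y = 0 := by
  rw [hΩ.frontier_eq] at hyf
  have h1 : ¬ ρ y < 0 := fun h => hyf.2 ((hρ.mem_iff y hy).2 h)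
  have hne : (𝓝[Ω] y).NeBot := mem_closure_iff_nhdsWithin_neBot.1 hyf.1
  have h2 : ρ y ≤ 0 := by
    refine le_of_tendsto ((hρ.differentiableAt hy).continuousAt.mono_left
      (nhdsWithin_le_nhds (s := Ω))) ?_
    filter_upwards [mem_nhdsWithin_of_mem_nhds (hρ.isOpen.mem_nhds hy), self_mem_nhdsWithin]
      with z hz hzΩ
    exact ((hρ.mem_iff z hz).1 hzΩ).le
  linarith

theorem IsDefiningFunction.fderiv_eq_inner (hρ : IsDefiningFunction Ω U ρ) {y : E3}
    (hy : y ∈ U) (x : E3) : fderiv ℝ ρ y x = inner ℝ (gradient ρ y) x := by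
  rw [(hρ.differentiableAt hy).hasGradientAt.hasFDerivAt.fderiv]
  simp

theorem IsDefiningFunction.isOutwardNormal (hρ : IsDefiningFunction Ω U ρ) {y : E3}
    (hy : y ∈ U) (hyf : y ∈ frontier Ω) :
    IsOutwardNormal Ω y (‖gradient ρ y‖⁻¹ • gradient ρ y) :=
  ⟨hyf, U, ρ, hy, hρ, rfl⟩

/-- A field pointing out of `Ω` or tangent along the boundary near `x₀` satisfies
`u·∇ρ ≥ C ρ` in `Ω` near `x₀`. -/
theorem IsDefiningFunction.lower_bound (hΩ : IsOpen Ω) (hρ : IsDefiningFunction Ω U ρ) {x₀ : E3}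
    (hx₀ : x₀ ∈ U) (hx₀f : x₀ ∈ frontier Ω) {I : Set ℝ} {u : ℝ → E3 → E3}
    {u' : ℝ → E3 → E3 →L[ℝ] E3} {r B : ℝ} (hr : 0 < r) (hB : 0 ≤ B)
    (huc : ∀ t ∈ I, ContinuousOn (u t) (closure Ω))
    (hud : ∀ t ∈ I, ∀ y ∈ Ω, HasFDerivAt (u t) (u' t y) y)
    (hu : ∀ t ∈ I, ∀ y ∈ Metric.ball x₀ r, y ∈ Ω → ‖u t y‖ ≤ B)
    (hu' : ∀ t ∈ I, ∀ y ∈ Metric.ball x₀ r, y ∈ Ω → ‖u' t y‖ ≤ B)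
    (hfr : ∀ t ∈ I, ∀ y ∈ Metric.ball x₀ r, y ∈ frontier Ω → 0 ≤ fderiv ℝ ρ y (u t y)) :
    ∃ h > 0, ∃ C, ∀ t ∈ I, ∀ y ∈ Metric.ball x₀ h, y ∈ Ω →
      C * ρ y ≤ fderiv ℝ ρ y (u t y) := by
  have hsm := hρ.contDiffAt hx₀
  have hsm1 : ContDiffAt ℝ ∞ (fderiv ℝ ρ) x₀ := hsm.fderiv_right (by simp)
  have hsm2 : ContDiffAt ℝ ∞ (fderiv ℝ (fderiv ℝ ρ)) x₀ := hsm1.fderiv_right (by simp)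
  set n := gradient ρ x₀ with hn
  have hn0 : n ≠ 0 := hρ.gradient_ne_zero x₀ hx₀
  have hnpos : 0 < ‖n‖ := norm_pos_iff.2 hn0
  -- At `x₀` the derivative of `ρ` along `n` is `‖n‖ ^ 2`; half of it survives as a lower bound
  -- nearby.
  set c := ‖n‖ ^ 2 / 2 with hc
  have hcpos : 0 < c := by positivity
  obtain ⟨B₂, hB₂⟩ : ∃ B₂, B₂ = max (‖fderiv ℝ ρ x₀‖) (‖fderiv ℝ (fderiv ℝ ρ) x₀‖) + 1 := ⟨_, rfl⟩
  have hB₂pos : 0 ≤ B₂ := by rw [hB₂]; positivity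
  have e1 : ∀ᶠ y in 𝓝 x₀, c < fderiv ℝ ρ y n := by
    have : ContinuousAt (fun y => fderiv ℝ ρ y n) x₀ := hsm1.continuousAt.clm_apply
      continuousAt_const
    refine this.eventually (lt_mem_nhds ?_)
    beta_reduce
    rw [hρ.fderiv_eq_inner hx₀, real_inner_self_eq_norm_sq]
    have : 0 < ‖n‖ ^ 2 := by positivity
    simp only [hc]
    linarith
  have e2 : ∀ᶠ y in 𝓝 x₀, ‖fderiv ℝ ρ y‖ < B₂ :=
    hsm1.continuousAt.norm.eventually (gt_mem_nhds
      (hB₂ ▸ lt_add_of_le_of_pos (le_max_left _ _) one_pos))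
  have e3 : ∀ᶠ y in 𝓝 x₀, ‖fderiv ℝ (fderiv ℝ ρ) y‖ < B₂ :=
    have hcont : ContinuousAt (fun y => ‖fderiv ℝ (fderiv ℝ ρ) y‖) x₀ :=
      (continuous_norm (E := E3 →L[ℝ] E3 →L[ℝ] ℝ)).continuousAt.comp hsm2.continuousAt
    hcont.eventually (gt_mem_nhds
      (hB₂ ▸ lt_add_of_le_of_pos (le_max_right _ _) one_pos))
  have eball : ∀ r > 0, ∀ᶠ y in 𝓝 x₀, y ∈ Metric.ball x₀ r := fun r hr =>
    Metric.ball_mem_nhds x₀ hr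
  have eU : ∀ᶠ y in 𝓝 x₀, y ∈ U := hρ.isOpen.mem_nhds hx₀
  obtain ⟨r₁, hr₁, hr₁s⟩ := Metric.eventually_nhds_iff_ball.1
    (((e1.and e2).and e3).and ((eball r hr).and eU))
  -- From `y`, the segment in direction `n` must reach `∂Ω` before leaving the ball where the bounds
  -- hold; `-ρ y / c * ‖n‖` bounds the length needed, and it vanishes at `x₀`.
  have e4 : ∀ᶠ y in 𝓝 x₀, dist y x₀ + -ρ y / c * ‖n‖ < r₁ := by
    have hcont : ContinuousAt (fun y => dist y x₀ + -ρ y / c * ‖n‖) x₀ := by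
      have := (hρ.differentiableAt hx₀).continuousAt
      fun_prop
    refine hcont.eventually (gt_mem_nhds ?_)
    beta_reduce
    rw [hρ.eq_zero hΩ hx₀ hx₀f]
    simpa using hr₁
  obtain ⟨h, hh, hhs⟩ := Metric.eventually_nhds_iff_ball.1
    (e4.and (eball r₁ hr₁))
  -- The two product-rule terms in the derivative of `∇ρ·u` along the segment: one from the Hessian
  -- of `ρ`, one from the Jacobian of `u`.
  set C₁ := B₂ * ‖n‖ * B + B₂ * (B * ‖n‖) with hC₁
  refine ⟨h, hh, C₁ / c, fun t ht y hy hyΩ => ?_⟩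
  obtain ⟨hyd, hyr₁⟩ := hhs y hy
  have hyU : y ∈ U := (hr₁s y hyr₁).2.2
  have hρy : ρ y < 0 := (hρ.mem_iff y hyU).1 hyΩ
  have hseg : ∀ s ∈ Icc 0 (-ρ y / c), y + s • n ∈ Metric.ball x₀ r₁ := by
    intro s hs
    rw [Metric.mem_ball]
    have h1 : dist (y + s • n) x₀ ≤ dist (y + s • n) y + dist y x₀ := dist_triangle _ _ _
    have h2 : dist (y + s • n) y = s * ‖n‖ := by
      simp [dist_eq_norm, norm_smul, abs_of_nonneg hs.1]
    have h3 : s * ‖n‖ ≤ -ρ y / c * ‖n‖ := by gcongr; exact hs.2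
    linarith
  have hline : ∀ s : ℝ, HasDerivAt (fun s : ℝ => y + s • n) n s := fun s => by
    simpa using ((hasDerivAt_id s).smul_const n).const_add y
  have hφ : ∀ s ∈ Icc 0 (-ρ y / c), HasDerivAt (fun s => ρ (y + s • n))
      (fderiv ℝ ρ (y + s • n) n) s := fun s hs =>
    HasFDerivAt.comp_hasDerivAt (f := fun s : ℝ => y + s • n) s
      (hρ.differentiableAt (hr₁s _ (hseg s hs)).2.2).hasFDerivAt (hline s)
  have hmemΩ : ∀ s ∈ Icc 0 (-ρ y / c), ρ (y + s • n) < 0 → y + s • n ∈ Ω := fun s hs hneg =>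
    (hρ.mem_iff _ (hr₁s _ (hseg s hs)).2.2).2 hneg
  have hd2 : ∀ s ∈ Icc 0 (-ρ y / c),
      HasFDerivAt (fderiv ℝ ρ) (fderiv ℝ (fderiv ℝ ρ) (y + s • n)) (y + s • n) := fun s hs =>
    (((hρ.contDiffAt (hr₁s _ (hseg s hs)).2.2).fderiv_right (m := ∞) (by simp)).differentiableAt
      (by simp)).hasFDerivAt
  have hcl : ∀ s ∈ Ioc 0 (-ρ y / c), (∀ s' ∈ Ico 0 s, ρ (y + s' • n) < 0) →
      ∀ s' ∈ Icc 0 s, y + s' • n ∈ closure Ω := by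
    intro s hs hneg s' hs'
    have hmaps : MapsTo (fun s : ℝ => y + s • n) (Ico 0 s) Ω := fun x hx =>
      hmemΩ x ⟨hx.1, hx.2.le.trans hs.2⟩ (hneg x hx)
    refine hmaps.closure (by fun_prop) ?_
    rwa [closure_Ico hs.1.ne]
  have key := lower_bound_of_nonneg_at_zero (φ := fun s => ρ (y + s • n))
    (φ' := fun s => fderiv ℝ ρ (y + s • n) n)
    (γ := fun s => fderiv ℝ ρ (y + s • n) (u t (y + s • n)))
    (γ' := fun s => fderiv ℝ (fderiv ℝ ρ) (y + s • n) n (u t (y + s • n))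
      + fderiv ℝ ρ (y + s • n) (u' t (y + s • n) n))
    (c := c) (C₁ := C₁) (a := -ρ y / c) hcpos (by positivity) (by simp) (by simpa using hρy) hφ
    (fun s hs => (hr₁s _ (hseg s hs)).1.1.1.le)
    (fun s hs _ hneg => ?_) (fun s hs hneg => ?_) (fun s hs hneg => ?_)
    (fun s hs h0 hneg => ?_)
  · simpa using key
  · have h1 : ContinuousOn (fun s : ℝ => fderiv ℝ ρ (y + s • n)) (Icc 0 s) := fun x hx =>
      (ContinuousAt.comp (f := fun s : ℝ => y + s • n)
        (hd2 x ⟨hx.1, hx.2.trans hs.2⟩).continuousAt (by fun_prop)).continuousWithinAt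
    have h2 : ContinuousOn (fun s : ℝ => u t (y + s • n)) (Icc 0 s) :=
      (huc t ht).comp (by fun_prop) (hcl s hs hneg)
    exact h1.clm_apply h2
  · have hmem := hmemΩ s hs hneg
    have h1 : HasDerivAt (fun s : ℝ => fderiv ℝ ρ (y + s • n))
        (fderiv ℝ (fderiv ℝ ρ) (y + s • n) n) s :=
      HasFDerivAt.comp_hasDerivAt (f := fun s : ℝ => y + s • n) s (hd2 s hs) (hline s)
    have h2 : HasDerivAt (fun s : ℝ => u t (y + s • n)) (u' t (y + s • n) n) s :=
      HasFDerivAt.comp_hasDerivAt (f := fun s : ℝ => y + s • n) s (hud t ht _ hmem) (hline s)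
    exact h1.clm_apply h2
  · have hmem := hmemΩ s hs hneg
    have hb := hr₁s _ (hseg s hs)
    have h1 : ‖fderiv ℝ (fderiv ℝ ρ) (y + s • n) n (u t (y + s • n))‖ ≤ B₂ * ‖n‖ * B :=
      (ContinuousLinearMap.le_opNorm _ _).trans (mul_le_mul
        ((ContinuousLinearMap.le_opNorm _ _).trans (by gcongr; exact hb.1.2.le))
        (hu t ht _ hb.2.1 hmem) (norm_nonneg _) (by positivity))
    have h2 : ‖fderiv ℝ ρ (y + s • n) (u' t (y + s • n) n)‖ ≤ B₂ * (B * ‖n‖) :=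
      (ContinuousLinearMap.le_opNorm _ _).trans (mul_le_mul hb.1.1.2.le
        ((ContinuousLinearMap.le_opNorm _ _).trans (by gcongr; exact hu' t ht _ hb.2.1 hmem))
        (norm_nonneg _) hB₂pos)
    exact add_le_add ((le_abs_self _).trans h1) ((le_abs_self _).trans h2)
  -- The hitting point is a limit of points of `Ω` and has `ρ = 0`, so it lies on the frontier,
  -- where the sign of the flux is known.
  · have hsI : s ∈ Icc 0 (-ρ y / c) := Ioc_subset_Icc_self hs
    have hb := hr₁s _ (hseg s hsI)
    refine hfr t ht _ hb.2.1 ?_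
    rw [hΩ.frontier_eq]
    refine ⟨hcl s hs hneg s ⟨hs.1.le, le_rfl⟩, fun hmem => ?_⟩
    have := (hρ.mem_iff _ hb.2.2).1 hmem
    linarith

end UnderwaterVehicle

/-! ### The vorticity equation -/

/-- If the spatial derivative `A` of `f` is strictly differentiable in `(t, y)`, then the time
derivative of `f` is differentiable in space, and the two derivatives commute. -/
theorem hasFDerivAt_deriv_of_hasStrictFDerivAt {E F : Type*} [NormedAddCommGroup E]
    [NormedSpace ℝ E] [NormedAddCommGroup F] [NormedSpace ℝ F] {f : ℝ → E → F}
    {A : ℝ × E → E →L[ℝ] F} {A' : ℝ × E →L[ℝ] (E →L[ℝ] F)} {t : ℝ} {y : E}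
    (hf : ∀ᶠ p in 𝓝 (t, y), HasFDerivAt (f p.1) (A p) p.2)
    (hA : HasStrictFDerivAt A A' (t, y))
    (ht : ∀ᶠ z in 𝓝 y, DifferentiableAt ℝ (fun s => f s z) t) :
    HasFDerivAt (fun z => deriv (fun s => f s z) t) (A' (1, 0)) y := by
  have hlim : Tendsto (fun n : ℝ × E => (t + n.1, n.2)) (𝓝[≠] (0 : ℝ) ×ˢ 𝓝 y) (𝓝 (t, y)) := by
    have hc : ContinuousAt (fun n : ℝ × E => (t + n.1, n.2)) (0, y) := by fun_prop
    have := hc.tendsto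
    simp only [add_zero] at this
    refine this.mono_left ?_
    rw [nhds_prod_eq]
    exact Filter.prod_mono nhdsWithin_le_nhds le_rfl
  have hlim0 : Tendsto (fun n : ℝ × E => (t, n.2)) (𝓝[≠] (0 : ℝ) ×ˢ 𝓝 y) (𝓝 (t, y)) :=
    ((Continuous.prodMk_right t).tendsto y).comp tendsto_snd
  have hne : ∀ᶠ n : ℝ × E in 𝓝[≠] (0 : ℝ) ×ˢ 𝓝 y, n.1 ≠ 0 :=
    tendsto_fst.eventually (self_mem_nhdsWithin (s := {(0 : ℝ)}ᶜ))
  refine hasFDerivAt_of_tendstoUniformlyOnFilter (l := 𝓝[≠] (0 : ℝ))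
    (f := fun n z => n⁻¹ • (f (t + n) z - f t z))
    (f' := fun n z => n⁻¹ • (A (t + n, z) - A (t, z))) (g' := fun _ => A' (1, 0)) ?_ ?_ ?_
  · rw [Metric.tendstoUniformlyOnFilter_iff]
    intro ε hε
    -- Strict differentiability compares two moving points `(t + n, z)` and `(t, z)`, which makes
    -- the convergence of the difference quotients of `A` uniform in `z`.
    have h1 := (hA.isLittleO.comp_tendsto (hlim.prodMk_nhds hlim0)).def (half_pos hε)
    filter_upwards [h1, hne] with n hn hn0
    simp only [Function.comp_apply, Prod.mk_sub_mk, add_sub_cancel_left, sub_self] at hn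
    have h2 : A' (n.1, 0) = n.1 • A' (1, 0) := by
      rw [← map_smul]
      simp
    have h3 : ‖((n.1, 0) : ℝ × E)‖ = ‖n.1‖ := by simp [Prod.norm_def]
    rw [h2, h3] at hn
    have h4 : n.1⁻¹ • (A (t + n.1, n.2) - A (t, n.2)) - A' (1, 0)
        = n.1⁻¹ • (A (t + n.1, n.2) - A (t, n.2) - n.1 • A' (1, 0)) := by
      rw [smul_sub n.1⁻¹ (_ - _), inv_smul_smul₀ hn0]
    rw [dist_comm, dist_eq_norm, h4, norm_smul, norm_inv]
    have h5 : 0 < ‖n.1‖ := norm_pos_iff.2 hn0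
    calc ‖n.1‖⁻¹ * _ ≤ ‖n.1‖⁻¹ * (ε / 2 * ‖n.1‖) := by gcongr
      _ = ε / 2 := by field_simp
      _ < ε := half_lt_self hε
  · filter_upwards [hlim.eventually hf, hlim0.eventually hf] with n h1 h2
    exact (h1.sub h2).const_smul n.1⁻¹
  · filter_upwards [ht] with z hz
    exact hz.hasDerivAt.tendsto_slope_zero

namespace UnderwaterVehicle

/-- The curl as a continuous linear map of the Jacobian. -/
noncomputable def curlCLM : (E3 →L[ℝ] E3) →L[ℝ] E3 :=
  LinearMap.toContinuousLinearMap
    { toFun := curlOf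
      map_add' := fun A B => by
        ext i
        fin_cases i <;> simp [curlOf] <;> ring
      map_smul' := fun c A => by
        ext i
        fin_cases i <;> simp [curlOf] <;> ring }

/-- The cross product by a fixed vector as a continuous linear map. -/
noncomputable def crossCLM (x : E3) : E3 →L[ℝ] E3 :=
  LinearMap.toContinuousLinearMap
    { toFun := cross x
      map_add' := fun y z => by
        ext i
        fin_cases i <;> simp [cross] <;> ring
      map_smul' := fun c y => by
        ext i
        fin_cases i <;> simp [cross] <;> ring }

@[simp]
theorem crossCLM_apply (x y : E3) : crossCLM x y = cross x y := rfl

theorem continuous_cross : Continuous fun p : E3 × E3 => cross p.1 p.2 := by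
  unfold cross
  refine (PiLp.continuous_toLp 2 _).comp (continuous_pi fun i => ?_)
  fin_cases i <;> simp <;> fun_prop

theorem inner_eq_coord (x y : E3) : inner ℝ x y = x 0 * y 0 + x 1 * y 1 + x 2 * y 2 := by
  simp [PiLp.inner_apply, Fin.sum_univ_three, mul_comm]

theorem inner_cross_self_right (x y : E3) : inner ℝ y (cross x y) = 0 := by
  rw [inner_eq_coord]
  simp [cross]
  ring

theorem apply_coord (A : E3 →L[ℝ] E3) (x : E3) (j : Fin 3) :
    A x j = x 0 * A (e 0) j + x 1 * A (e 1) j + x 2 * A (e 2) j := by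
  have hx : x = x 0 • e 0 + x 1 • e 1 + x 2 • e 2 := by
    ext i
    fin_cases i <;> simp [e]
  conv_lhs => rw [hx]
  simp

theorem e_apply (i j : Fin 3) : e i j = if j = i then 1 else 0 := by
  simp [e]

/-- The algebraic identity behind the vorticity equation: the curl of the differentiated momentum
equation, for a divergence free field and a symmetric pressure Hessian. -/
theorem curl_identity {A P S : E3 →L[ℝ] E3} {Q : E3 →L[ℝ] E3 →L[ℝ] E3} {r u : E3}
    (hQ : ∀ h k, Q h k = Q k h) (hS : ∀ h k, inner ℝ (S h) k = inner ℝ (S k) h)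
    (hdiv : divOf A = 0)
    (hmom : ∀ h, P h + Q h u + A (A h - cross r h) + cross r (A h) + S h = 0) :
    curlOf P + curlOf (Q u) = A (curlOf A) - cross r (curlOf A) := by
  have hS' : ∀ i j, S (e i) j = S (e j) i := by
    intro i j
    simpa [e, EuclideanSpace.inner_single_right] using hS (e i) (e j)
  have hm : ∀ i j, P (e i) j + Q u (e i) j + A (A (e i) - cross r (e i)) j
      + cross r (A (e i)) j + S (e i) j = 0 := by
    intro i j
    have := congrArg (fun x : E3 => x j) (hmom (e i))
    simpa [hQ (e i) u] using this
  simp only [divOf, Fin.sum_univ_three] at hdiv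
  have h01 := hm 0 1
  have h02 := hm 0 2
  have h10 := hm 1 0
  have h12 := hm 1 2
  have h20 := hm 2 0
  have h21 := hm 2 1
  rw [apply_coord A] at h01 h02 h10 h12 h20 h21
  simp [cross, e_apply] at h01 h02 h10 h12 h20 h21
  have s01 := hS' 0 1
  have s02 := hS' 0 2
  have s12 := hS' 1 2
  ext i
  fin_cases i
  all_goals
    simp only [Fin.zero_eta, Fin.mk_one, Fin.reduceFinMk, PiLp.add_apply, PiLp.sub_apply]
    rw [apply_coord A]
    simp [curlOf, cross]
  -- The antisymmetric part of `A ∘ A` has curl `(div v) ζ - A ζ`, which explains the multiple of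
  -- `hdiv`; the pressure Hessian cancels by symmetry.
  · linear_combination h12 - h21 - s12 - ((A (e 1)) 2 - (A (e 2)) 1) * hdiv
  · linear_combination h20 - h02 + s02 - ((A (e 2)) 0 - (A (e 0)) 2) * hdiv
  · linear_combination h01 - h10 - s01 - ((A (e 0)) 1 - (A (e 1)) 0) * hdiv

variable {Ω : Set E3} {T : ℝ} {v : ℝ → E3 → E3}

theorem IsClassicalField.hasFDerivAt (hv : IsClassicalField T Ω v) (hΩ : IsOpen Ω) {t : ℝ}
    (ht : t ∈ Icc 0 T) {y : E3} (hy : y ∈ Ω) : HasFDerivAt (v t) (jac Ω v t y) y :=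
  (hv.differentiableOn t ht y (subset_closure hy)).hasFDerivWithinAt.hasFDerivAt
    (mem_of_superset (hΩ.mem_nhds hy) subset_closure)

theorem IsClassicalField.vorticity_continuousOn (hv : IsClassicalField T Ω v) :
    ContinuousOn (fun p : ℝ × E3 => vorticity Ω v p.1 p.2) (Icc 0 T ×ˢ closure Ω) :=
  curlCLM.continuous.comp_continuousOn hv.jac_continuousOn

/-- The gradient of a differentiable function is the field of a symmetric Jacobian. -/
theorem gradient_jacobian_symm {q : E3 → ℝ} {S : E3 →L[ℝ] E3} {y : E3}
    (hq : ∀ᶠ z in 𝓝 y, DifferentiableAt ℝ q z) (hS : HasFDerivAt (gradient q) S y) (h k : E3) :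
    inner ℝ (S h) k = inner ℝ (S k) h := by
  let D : E3 →L[ℝ] (E3 →L[ℝ] ℝ) := LinearMap.toContinuousLinearMap
    { toFun := fun x => InnerProductSpace.toDual ℝ E3 x
      map_add' := fun x y => map_add _ x y
      map_smul' := fun c x => by simp }
  have hD : ∀ x y, D x y = inner ℝ x y := fun x y => InnerProductSpace.toDual_apply_apply
  have h1 : ∀ᶠ z in 𝓝 y, HasFDerivAt q (D (gradient q z)) z := by
    filter_upwards [hq] with z hz
    exact hz.hasGradientAt.hasFDerivAt
  have h2 : HasFDerivAt (fun z => D (gradient q z)) (D.comp S) y :=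
    D.hasFDerivAt.comp y hS
  simpa [hD] using second_derivative_symmetric_of_eventually h1 h2 h k

/-- The vorticity equation. -/
theorem IsFluidSolution.vorticity_equation {m : ℕ} {χ : Fin m → E3 → ℝ} {w : Fin m → ℝ → ℝ}
    {l r : ℝ → E3} {q : ℝ → E3 → ℝ} (hsol : IsFluidSolution T Ω χ w l r v q) (hΩ : IsOpen Ω)
    {t : ℝ} (ht : t ∈ Ioo 0 T) {y : E3} (hy : y ∈ Ω) :
    ∃ Z : ℝ × E3 →L[ℝ] E3, HasFDerivAt (fun p : ℝ × E3 => vorticity Ω v p.1 p.2) Z (t, y) ∧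
      Z (1, v t y - l t - cross (r t) y)
        = jac Ω v t y (vorticity Ω v t y) - cross (r t) (vorticity Ω v t y) := by
  have hv := hsol.regular
  have hO : IsOpen (Ioo 0 T ×ˢ Ω) := isOpen_Ioo.prod hΩ
  have hyn : ∀ᶠ z in 𝓝 y, z ∈ Ω := hΩ.mem_nhds hy
  have hJ : HasStrictFDerivAt (fun p : ℝ × E3 => jac Ω v p.1 p.2)
      (fderiv ℝ (fun p : ℝ × E3 => jac Ω v p.1 p.2) (t, y)) (t, y) :=
    (hv.jac_contDiffOn.contDiffAt (hO.mem_nhds ⟨ht, hy⟩)).hasStrictFDerivAt one_ne_zero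
  set J' := fderiv ℝ (fun p : ℝ × E3 => jac Ω v p.1 p.2) (t, y)
  have hJy : HasFDerivAt (fun z => jac Ω v t z) (J'.comp (.inr ℝ ℝ E3)) y :=
    hJ.hasFDerivAt.comp (f := fun z : E3 => (t, z)) y (hasFDerivAt_prodMk_right t y)
  have hvt : HasFDerivAt (fun z => deriv (fun s => v s z) t) (J' (1, 0)) y := by
    refine hasFDerivAt_deriv_of_hasStrictFDerivAt ?_ hJ ?_
    · filter_upwards [hO.mem_nhds (show (t, y) ∈ _ from ⟨ht, hy⟩)] with p hp
      exact hv.hasFDerivAt hΩ (Ioo_subset_Icc_self hp.1) hp.2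
    · filter_upwards [hyn] with z hz
      have h1 : DifferentiableAt ℝ (fun p : ℝ × E3 => v p.1 p.2) (t, z) :=
        (hv.contDiffOn.contDiffAt (hO.mem_nhds ⟨ht, hz⟩)).differentiableAt one_ne_zero
      exact h1.comp (f := fun s : ℝ => (s, z)) t (by fun_prop)
  have hvy := hv.hasFDerivAt hΩ (Ioo_subset_Icc_self ht) hy
  have hvy' : ∀ᶠ z in 𝓝 y, HasFDerivAt (v t) (jac Ω v t z) z := by
    filter_upwards [hyn] with z hz using hv.hasFDerivAt hΩ (Ioo_subset_Icc_self ht) hz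
  have hu : HasFDerivAt (fun z => v t z - l t - cross (r t) z)
      (jac Ω v t y - crossCLM (r t)) y :=
    (hvy.sub_const (l t)).sub (crossCLM (r t)).hasFDerivAt
  have hrv : HasFDerivAt (fun z => cross (r t) (v t z))
      ((crossCLM (r t)).comp (jac Ω v t y)) y := (crossCLM (r t)).hasFDerivAt.comp y hvy
  have hN := ((hvt.add (hJy.clm_apply hu)).add hrv).neg
  -- The pressure is only assumed differentiable; the momentum equation itself shows that its
  -- gradient is differentiable.
  have hgrad := hN.congr_of_eventuallyEq (f₁ := gradient (q t)) (by
    filter_upwards [hyn] with z hz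
    have := hsol.momentum t ht z hz
    exact eq_neg_of_add_eq_zero_right this)
  have hsymm := gradient_jacobian_symm (by
    filter_upwards [hyn] with z hz
    exact (hsol.pressure_differentiableOn t ht).differentiableAt (hΩ.mem_nhds hz)) hgrad
  have hid := curl_identity (A := jac Ω v t y) (P := J' (1, 0)) (Q := J'.comp (.inr ℝ ℝ E3))
    (r := r t) (u := v t y - l t - cross (r t) y)
    (second_derivative_symmetric_of_eventually hvy' hJy) hsymm (hsol.div_free t ht y hy)
    (fun h => by simp; abel)
  refine ⟨curlCLM.comp J', curlCLM.hasFDerivAt.comp (t, y) hJ.hasFDerivAt, ?_⟩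
  rw [show ((1, v t y - l t - cross (r t) y) : ℝ × E3)
    = (1, 0) + (0, v t y - l t - cross (r t) y) by simp, map_add]
  exact hid

end UnderwaterVehicle

/-! ### Relative velocity and flux through the boundary -/

namespace UnderwaterVehicle

theorem norm_cross_le (x y : E3) : ‖cross x y‖ ≤ ‖x‖ * ‖y‖ := by
  refine le_of_sq_le_sq ?_ (by positivity)
  rw [mul_pow, EuclideanSpace.real_norm_sq_eq, EuclideanSpace.real_norm_sq_eq,
    EuclideanSpace.real_norm_sq_eq]
  simp only [Fin.sum_univ_three]
  simp [cross]
  linarith [sq_nonneg (x 0 * y 0 + x 1 * y 1 + x 2 * y 2)]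

theorem norm_crossCLM_le (x : E3) : ‖crossCLM x‖ ≤ ‖x‖ :=
  ContinuousLinearMap.opNorm_le_bound _ (norm_nonneg _) (norm_cross_le x)

/-- The velocity of the fluid relative to the body. -/
def relVel (v : ℝ → E3 → E3) (l r : ℝ → E3) (t : ℝ) (y : E3) : E3 :=
  v t y - l t - cross (r t) y

variable {Ω : Set E3} {T : ℝ} {v : ℝ → E3 → E3} {l r : ℝ → E3}

theorem IsClassicalField.relVel_continuousOn (hv : IsClassicalField T Ω v)
    (hl : ContinuousOn l (Icc 0 T)) (hr : ContinuousOn r (Icc 0 T)) :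
    ContinuousOn (fun p : ℝ × E3 => relVel v l r p.1 p.2) (Icc 0 T ×ˢ closure Ω) := by
  have h1 : ContinuousOn (fun p : ℝ × E3 => l p.1) (Icc 0 T ×ˢ closure Ω) :=
    hl.comp continuousOn_fst fun p hp => hp.1
  have h2 : ContinuousOn (fun p : ℝ × E3 => r p.1) (Icc 0 T ×ˢ closure Ω) :=
    hr.comp continuousOn_fst fun p hp => hp.1
  exact (hv.continuousOn.sub h1).sub
    (continuous_cross.comp_continuousOn (h2.prodMk continuousOn_snd))

theorem IsClassicalField.relVel_hasFDerivAt (hv : IsClassicalField T Ω v) (hΩ : IsOpen Ω) {t : ℝ}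
    (ht : t ∈ Icc 0 T) {y : E3} (hy : y ∈ Ω) :
    HasFDerivAt (relVel v l r t) (jac Ω v t y - crossCLM (r t)) y :=
  ((hv.hasFDerivAt hΩ ht hy).sub_const (l t)).sub (crossCLM (r t)).hasFDerivAt

/-- The unbounded part `r × y` of the velocity is orthogonal to `y`, and what remains is controlled
by `2‖y‖ ≤ 1 + ‖y‖²`. This is what makes `coneWeight` nonincreasing along the flow. -/
theorem inner_relVel_le {C : ℝ} {t : ℝ} {y : E3} (h : ‖v t y‖ + ‖l t‖ ≤ C) :
    0 ≤ C * (1 + ‖y‖ ^ 2) + 2 * inner ℝ y (relVel v l r t y) := by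
  have h1 : inner ℝ y (relVel v l r t y) = inner ℝ y (v t y - l t) := by
    rw [relVel, inner_sub_right, inner_cross_self_right, sub_zero]
  have h2 := (abs_le.1 (abs_real_inner_le_norm y (v t y - l t))).1
  have h3 : ‖y‖ * ‖v t y - l t‖ ≤ ‖y‖ * C := by
    gcongr
    exact (norm_sub_le _ _).trans h
  have hC : 0 ≤ C := (by positivity : 0 ≤ ‖v t y‖ + ‖l t‖).trans h
  rw [h1]
  nlinarith [mul_nonneg hC (sq_nonneg (1 - ‖y‖))]

section Solution

variable {m : ℕ} {χ : Fin m → E3 → ℝ} {w : Fin m → ℝ → ℝ} {q : ℝ → E3 → ℝ}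

/-- The flux through the boundary, in terms of a defining function. -/
theorem IsFluidSolution.flux_eq (hsol : IsFluidSolution T Ω χ w l r v q) {U : Set E3} {ρ : E3 → ℝ}
    (hρ : IsDefiningFunction Ω U ρ) {t : ℝ} (ht : t ∈ Ioo 0 T) {y : E3} (hyU : y ∈ U)
    (hy : y ∈ frontier Ω) :
    fderiv ℝ ρ y (relVel v l r t y) = ‖gradient ρ y‖ * ∑ j, w j t * χ j y := by
  have h1 := hsol.boundary t ht y hy _ (hρ.isOutwardNormal hyU hy)
  have hne : ‖gradient ρ y‖ ≠ 0 := norm_ne_zero_iff.2 (hρ.gradient_ne_zero y hyU)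
  rw [inner_smul_right, inner_smul_right, inner_add_left] at h1
  rw [hρ.fderiv_eq_inner hyU, real_inner_comm, relVel, inner_sub_left, inner_sub_left]
  field_simp at h1
  linarith

/-- Near a boundary point with nonzero vorticity, no fluid enters the domain. -/
theorem IsFluidSolution.flux_nonneg (hsol : IsFluidSolution T Ω χ w l r v q)
    (hl : ContinuousOn l (Icc 0 T)) (hr : ContinuousOn r (Icc 0 T))
    (hinflow : ∀ t ∈ Ioo 0 T, ∀ y ∈ ⋃ j, bdrySupport Ω (χ j),
      ∑ j, w j t * χ j y ≤ 0 → vorticity Ω v t y = 0)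
    {U : Set E3} {ρ : E3 → ℝ} (hρ : IsDefiningFunction Ω U ρ) {t₀ : ℝ} (ht₀ : t₀ ∈ Ioo 0 T)
    {x₀ : E3} (hxU : x₀ ∈ U) (hx₀ : x₀ ∈ frontier Ω) (hne : vorticity Ω v t₀ x₀ ≠ 0) :
    ∀ᶠ p : ℝ × E3 in 𝓝 (t₀, x₀), p.2 ∈ frontier Ω → 0 ≤ fderiv ℝ ρ p.2 (relVel v l r p.1 p.2) := by
  have hI : ∀ᶠ p : ℝ × E3 in 𝓝 (t₀, x₀), p.1 ∈ Ioo 0 T :=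
    continuousAt_fst.eventually (isOpen_Ioo.mem_nhds ht₀)
  have hU : ∀ᶠ p : ℝ × E3 in 𝓝 (t₀, x₀), p.2 ∈ U :=
    continuousAt_snd.eventually (hρ.isOpen.mem_nhds hxU)
  by_cases hsupp : x₀ ∈ ⋃ j, bdrySupport Ω (χ j)
  · have hpos : 0 < ∑ j, w j t₀ * χ j x₀ := by
      by_contra! h
      exact hne (hinflow t₀ ht₀ x₀ hsupp h)
    have hflux : 0 < fderiv ℝ ρ x₀ (relVel v l r t₀ x₀) := by
      rw [hsol.flux_eq hρ ht₀ hxU hx₀]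
      exact mul_pos (norm_pos_iff.2 (hρ.gradient_ne_zero x₀ hxU)) hpos
    -- The controls need not be continuous in time, so strict outflow at `(t₀, x₀)` is propagated to
    -- nearby points by continuity of the velocity up to the boundary.
    have hc : ContinuousWithinAt (fun p : ℝ × E3 => fderiv ℝ ρ p.2 (relVel v l r p.1 p.2))
        (Icc 0 T ×ˢ closure Ω) (t₀, x₀) := by
      have h1 : ContinuousAt (fun p : ℝ × E3 => fderiv ℝ ρ p.2) (t₀, x₀) :=
        ContinuousAt.comp (f := fun p : ℝ × E3 => p.2) (g := fderiv ℝ ρ)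
          ((hρ.contDiffAt hxU).fderiv_right (m := ∞) (by simp)).continuousAt continuousAt_snd
      exact h1.continuousWithinAt.clm_apply (hsol.regular.relVel_continuousOn hl hr _
        ⟨Ioo_subset_Icc_self ht₀, frontier_subset_closure hx₀⟩)
    have hev := eventually_nhdsWithin_iff.1 (hc.eventually (lt_mem_nhds hflux))
    filter_upwards [hev, hI] with p hp hpI hpf
    exact (hp ⟨Ioo_subset_Icc_self hpI, frontier_subset_closure hpf⟩).le
  -- Away from the finitely many closed supports, the wall is impermeable and the flux vanishes on a
  -- whole neighbourhood.
  · have hclosed : IsClosed (⋃ j, bdrySupport Ω (χ j)) :=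
      isClosed_iUnion_of_finite fun j => isClosed_closure
    have hout : ∀ᶠ p : ℝ × E3 in 𝓝 (t₀, x₀), p.2 ∈ (⋃ j, bdrySupport Ω (χ j))ᶜ :=
      continuousAt_snd.eventually (hclosed.isOpen_compl.mem_nhds hsupp)
    filter_upwards [hI, hU, hout] with p hpI hpU hpo hpf
    rw [hsol.flux_eq hρ hpI hpU hpf, Finset.sum_eq_zero, mul_zero]
    intro j _
    by_contra hj
    exact hpo (mem_iUnion.2 ⟨j, subset_closure ⟨hpf, right_ne_zero_of_mul hj⟩⟩)

/-! ### The weighted enstrophy -/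

/-- A weight that decreases along the flow and is positive in a bounded set only. -/
noncomputable def coneWeight (C R : ℝ) (p : ℝ × E3) : ℝ := R - Real.exp (C * p.1) * (1 + ‖p.2‖ ^ 2)

theorem continuous_coneWeight (C R : ℝ) : Continuous (coneWeight C R) := by
  unfold coneWeight
  fun_prop

theorem norm_le_of_coneWeight_nonneg {C R : ℝ} (hC : 0 ≤ C) {p : ℝ × E3} (hp : 0 ≤ p.1)
    (h : 0 ≤ coneWeight C R p) : ‖p.2‖ ≤ R := by
  have h1 : 1 ≤ Real.exp (C * p.1) := Real.one_le_exp (mul_nonneg hC hp)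
  have h2 : 1 * (1 + ‖p.2‖ ^ 2) ≤ Real.exp (C * p.1) * (1 + ‖p.2‖ ^ 2) := by gcongr
  unfold coneWeight at h
  nlinarith [sq_nonneg (‖p.2‖ - 1)]

theorem exists_hasFDerivAt_coneWeight (C R : ℝ) {t : ℝ} {y : E3} (h : ‖v t y‖ + ‖l t‖ ≤ C) :
    ∃ Θ : ℝ × E3 →L[ℝ] ℝ, HasFDerivAt (coneWeight C R) Θ (t, y) ∧
      Θ (1, relVel v l r t y) ≤ 0 := by
  have h1 : HasFDerivAt (fun p : ℝ × E3 => Real.exp (C * p.1))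
      (Real.exp (C * t) • C • ContinuousLinearMap.fst ℝ ℝ E3) (t, y) :=
    (HasFDerivAt.const_mul (hasFDerivAt_fst (p := (t, y))) C).exp
  have h2 : HasFDerivAt (fun p : ℝ × E3 => 1 + ‖p.2‖ ^ 2)
      (2 • (innerSL ℝ y).comp (ContinuousLinearMap.snd ℝ ℝ E3)) (t, y) :=
    (hasFDerivAt_snd (p := (t, y))).norm_sq.const_add 1
  refine ⟨_, (h1.mul h2).const_sub R, ?_⟩
  have h3 := mul_nonneg (Real.exp_pos (C * t)).le (inner_relVel_le (r := r) h)
  simp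
  linarith

/-- The weighted enstrophy density, to which the maximum principle applies. -/
noncomputable def weightedEnstrophy (Ω : Set E3) (v : ℝ → E3 → E3) (K C R : ℝ) (p : ℝ × E3) :
    ℝ :=
  Real.exp (-K * p.1) * ‖vorticity Ω v p.1 p.2‖ ^ 2 * coneWeight C R p

/-- Stretching contributes at most `2B‖ζ‖²` and the rotation term is orthogonal to `ζ`, so the
damping rate `1 + 2 * B` leaves exactly `-F`. Nonnegativity of the weight lets this estimate be
multiplied by it. -/
theorem IsFluidSolution.exists_hasFDerivAt_weightedEnstrophy
    (hsol : IsFluidSolution T Ω χ w l r v q) (hΩ : IsOpen Ω) {t : ℝ} (ht : t ∈ Ioo 0 T) {y : E3}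
    (hy : y ∈ Ω) {B C R : ℝ} (hB : ‖jac Ω v t y‖ ≤ B) (hC : ‖v t y‖ + ‖l t‖ ≤ C)
    (hR : 0 ≤ coneWeight C R (t, y)) :
    ∃ F' : ℝ × E3 →L[ℝ] ℝ, HasFDerivAt (weightedEnstrophy Ω v (1 + 2 * B) C R) F' (t, y) ∧
      F' (1, relVel v l r t y) ≤ -weightedEnstrophy Ω v (1 + 2 * B) C R (t, y) := by
  obtain ⟨Z, hZ, hZe⟩ := hsol.vorticity_equation hΩ ht hy
  obtain ⟨Θ, hΘ, hΘe⟩ := exists_hasFDerivAt_coneWeight (r := r) C R hC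
  obtain ⟨K, hK⟩ : ∃ K, K = 1 + 2 * B := ⟨_, rfl⟩
  rw [← hK]
  have h1 : HasFDerivAt (fun p : ℝ × E3 => Real.exp (-K * p.1))
      (Real.exp (-K * t) • (-K) • ContinuousLinearMap.fst ℝ ℝ E3) (t, y) :=
    (HasFDerivAt.const_mul (hasFDerivAt_fst (p := (t, y))) _).exp
  refine ⟨_, (h1.mul hZ.norm_sq).mul hΘ, ?_⟩
  set ζ := vorticity Ω v t y with hζ
  have hin : inner ℝ ζ (Z (1, relVel v l r t y)) ≤ B * ‖ζ‖ ^ 2 := by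
    rw [relVel, hZe, inner_sub_right, inner_cross_self_right, sub_zero]
    calc inner ℝ ζ (jac Ω v t y ζ) ≤ ‖ζ‖ * ‖jac Ω v t y ζ‖ := real_inner_le_norm _ _
      _ ≤ ‖ζ‖ * (B * ‖ζ‖) := by
        gcongr
        exact (ContinuousLinearMap.le_opNorm _ _).trans (by gcongr)
      _ = B * ‖ζ‖ ^ 2 := by ring
  have hE := Real.exp_pos (-K * t)
  set E := Real.exp (-K * t) with hEdef
  set θ := coneWeight C R (t, y) with hθ
  have k1 : E * ‖ζ‖ ^ 2 * Θ (1, relVel v l r t y) ≤ 0 :=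
    mul_nonpos_of_nonneg_of_nonpos (by positivity) hΘe
  have k2 : θ * E * inner ℝ ζ (Z (1, relVel v l r t y)) ≤ θ * E * (B * ‖ζ‖ ^ 2) := by gcongr
  have hgoal : E * ‖ζ‖ ^ 2 * Θ (1, relVel v l r t y)
      + θ * (E * (2 * inner ℝ ζ (Z (1, relVel v l r t y)))
        + ‖ζ‖ ^ 2 * (E * -K)) ≤ -(E * ‖ζ‖ ^ 2 * θ) := by
    rw [hK]
    linarith
  have hE' : Real.exp (-(K * t)) = E := by rw [hEdef, neg_mul]
  simp [weightedEnstrophy, ← hζ, hE', ← hθ]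
  linarith

theorem IsClassicalField.weightedEnstrophy_continuousOn (hv : IsClassicalField T Ω v) (K C R : ℝ) :
    ContinuousOn (weightedEnstrophy Ω v K C R) (Icc 0 T ×ˢ closure Ω) := by
  have h1 := hv.vorticity_continuousOn
  have h2 := continuous_coneWeight C R
  unfold weightedEnstrophy
  exact (ContinuousOn.mul (by fun_prop) (h1.norm.pow 2)).mul h2.continuousOn

/-- Excludes time `0` for the maximum even when the maximum point lies on `∂Ω`. -/
theorem IsClassicalField.vorticity_zero_closure (hv : IsClassicalField T Ω v) (hT : 0 ≤ T)
    (hinit : ∀ y ∈ Ω, vorticity Ω v 0 y = 0) {y : E3} (hy : y ∈ closure Ω) :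
    vorticity Ω v 0 y = 0 := by
  have h0 : (0 : ℝ) ∈ Icc 0 T := ⟨le_rfl, hT⟩
  have hc : ContinuousOn (fun y => vorticity Ω v 0 y) (closure Ω) :=
    hv.vorticity_continuousOn.comp (f := fun y : E3 => ((0 : ℝ), y)) (by fun_prop)
      fun y hy => ⟨h0, hy⟩
  have hne : (𝓝[Ω] y).NeBot := mem_closure_iff_nhdsWithin_neBot.1 hy
  refine tendsto_nhds_unique ((hc y hy).mono_left (nhdsWithin_mono _ subset_closure)) ?_
  refine tendsto_const_nhds.congr' ?_
  filter_upwards [self_mem_nhdsWithin] with z hz using (hinit z hz).symm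

/-! ### The contradiction at a positive maximum -/

/-- No vorticity at interior times. -/
theorem IsFluidSolution.vorticity_eq_zero_of_mem_Ioo (hsol : IsFluidSolution T Ω χ w l r v q)
    (hΩ : IsSmoothDomain Ω) (hl : ContinuousOn l (Icc 0 T)) (hr : ContinuousOn r (Icc 0 T))
    (hinit : ∀ y ∈ Ω, vorticity Ω v 0 y = 0)
    (hinflow : ∀ t ∈ Ioo 0 T, ∀ y ∈ ⋃ j, bdrySupport Ω (χ j),
      ∑ j, w j t * χ j y ≤ 0 → vorticity Ω v t y = 0)
    {t₁ : ℝ} (ht₁ : t₁ ∈ Ioo 0 T) {y₁ : E3} (hy₁ : y₁ ∈ Ω) : vorticity Ω v t₁ y₁ = 0 := by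
  by_contra hne
  have hv := hsol.regular
  have hT : 0 ≤ T := (ht₁.1.trans ht₁.2).le
  obtain ⟨C, hC0, hC⟩ : ∃ C, 0 ≤ C ∧ ∀ t ∈ Icc 0 T, ∀ y ∈ Ω, ‖v t y‖ + ‖l t‖ ≤ C := by
    obtain ⟨Cv, hCv⟩ := hv.bounded
    obtain ⟨Cl, hCl⟩ := isCompact_Icc.exists_bound_of_continuousOn hl
    have hle : ∀ t ∈ Icc 0 T, ∀ y ∈ Ω, ‖v t y‖ + ‖l t‖ ≤ Cv + Cl := fun t ht y hy =>
      add_le_add (hCv t ht y hy) (hCl t ht)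
    exact ⟨_, (by positivity : (0 : ℝ) ≤ ‖v t₁ y₁‖ + ‖l t₁‖).trans
      (hle t₁ (Ioo_subset_Icc_self ht₁) y₁ hy₁), hle⟩
  obtain ⟨R, hR⟩ : ∃ R, coneWeight C R (t₁, y₁) = 1 :=
    ⟨Real.exp (C * t₁) * (1 + ‖y₁‖ ^ 2) + 1, by simp [coneWeight]⟩
  have hθc := continuous_coneWeight C R
  set Q : Set (ℝ × E3) := (Icc 0 t₁ ×ˢ closure Ω) ∩ coneWeight C R ⁻¹' Ici 0 with hQ
  have hQT : Q ⊆ Icc 0 T ×ˢ closure Ω := fun p hp =>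
    ⟨⟨hp.1.1.1, hp.1.1.2.trans ht₁.2.le⟩, hp.1.2⟩
  have hQc : IsCompact Q := by
    refine (IsCompact.prod (isCompact_Icc (a := 0) (b := t₁)) (isCompact_closedBall (0 : E3) R)).of_isClosed_subset
      ((isClosed_Icc.prod isClosed_closure).inter (isClosed_Ici.preimage hθc))
      (fun p hp => ⟨hp.1.1, ?_⟩)
    rw [mem_closedBall_zero_iff]
    exact norm_le_of_coneWeight_nonneg hC0 hp.1.1.1 hp.2
  obtain ⟨B, hB⟩ := hQc.exists_bound_of_continuousOn (hv.jac_continuousOn.mono hQT)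
  set F := weightedEnstrophy Ω v (1 + 2 * B) C R with hF
  have hFc : ContinuousOn F (Icc 0 T ×ˢ closure Ω) := hv.weightedEnstrophy_continuousOn _ C R
  have hmem₁ : (t₁, y₁) ∈ Q :=
    ⟨⟨⟨ht₁.1.le, le_rfl⟩, subset_closure hy₁⟩, by simp [hR]⟩
  obtain ⟨⟨t₀, x₀⟩, ⟨⟨ht₀, hx₀⟩, hθ₀⟩, hmax⟩ := hQc.exists_isMaxOn ⟨_, hmem₁⟩ (hFc.mono hQT)
  simp only at ht₀ hx₀
  have hF₀ : 0 < F (t₀, x₀) := by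
    refine lt_of_lt_of_le ?_ (hmax hmem₁)
    simp only [hF, weightedEnstrophy, hR]
    have := norm_pos_iff.2 hne
    positivity
  have hζ₀ : vorticity Ω v t₀ x₀ ≠ 0 := by
    intro h
    simp [hF, weightedEnstrophy, h] at hF₀
  have hθpos : 0 < coneWeight C R (t₀, x₀) := by
    refine lt_of_le_of_ne hθ₀ fun h => ?_
    simp [hF, weightedEnstrophy, ← h] at hF₀
  have ht₀pos : 0 < t₀ := by
    refine lt_of_le_of_ne ht₀.1 ?_
    rintro rfl
    exact hζ₀ (hv.vorticity_zero_closure hT hinit hx₀)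
  have ht₀I : t₀ ∈ Ioo 0 T := ⟨ht₀pos, ht₀.2.trans_lt ht₁.2⟩
  -- Outside `Q` the weight is negative, so `F ≤ 0` there and the maximum over `Q` is global over
  -- the past.
  have hFle : ∀ t ∈ Icc 0 t₁, ∀ y ∈ closure Ω, F (t, y) ≤ F (t₀, x₀) := by
    intro t ht y hy
    rcases le_or_gt 0 (coneWeight C R (t, y)) with h | h
    · exact hmax ⟨⟨ht, hy⟩, h⟩
    · refine le_trans ?_ hF₀.le
      exact mul_nonpos_of_nonneg_of_nonpos (by positivity) h.le
  -- uniform bounds near `(t₀, x₀)`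
  have hcomp : IsCompact (Icc 0 T ×ˢ (Metric.closedBall x₀ 1 ∩ closure Ω)) :=
    isCompact_Icc.prod ((isCompact_closedBall x₀ 1).inter_right isClosed_closure)
  have hsub : Icc 0 T ×ˢ (Metric.closedBall x₀ 1 ∩ closure Ω) ⊆ Icc 0 T ×ˢ closure Ω :=
    prod_mono le_rfl inter_subset_right
  have huc := hv.relVel_continuousOn hl hr
  obtain ⟨B₁, hB₁⟩ := hcomp.exists_bound_of_continuousOn (huc.mono hsub)
  obtain ⟨B₂, hB₂⟩ := hcomp.exists_bound_of_continuousOn (hv.jac_continuousOn.mono hsub)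
  obtain ⟨B₃, hB₃⟩ := isCompact_Icc.exists_bound_of_continuousOn hr
  have e1 : ∀ᶠ p : ℝ × E3 in 𝓝 (t₀, x₀), p.1 ∈ Ioo 0 T :=
    continuousAt_fst.eventually (isOpen_Ioo.mem_nhds ht₀I)
  have e2 : ∀ᶠ p : ℝ × E3 in 𝓝 (t₀, x₀), 0 < coneWeight C R p :=
    hθc.continuousAt.eventually (lt_mem_nhds hθpos)
  -- it remains to find a barrier near `x₀`
  suffices hbarrier : ∃ h > 0, ∃ c : ℝ, ∃ (b : E3 → ℝ) (b' : E3 → E3 →L[ℝ] ℝ),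
      ∀ p ∈ Metric.closedBall (t₀, x₀) h, ContinuousAt b p.2 ∧ (p.2 ∈ Ω ↔ 0 < b p.2) ∧
        (p.2 ∈ Ω → HasFDerivAt b (b' p.2) p.2) ∧
        (p.2 ∈ Ω → b' p.2 (relVel v l r p.1 p.2) ≤ c * b p.2) by
    obtain ⟨h₁, hh₁, c, b, b', hb⟩ := hbarrier
    obtain ⟨h₂, hh₂, h₂s⟩ := Metric.eventually_nhds_iff_ball.1 (e1.and e2)
    obtain ⟨h, hh, hhm⟩ : ∃ h > 0, h ≤ h₁ ∧ h < h₂ ∧ h ≤ 1 :=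
      ⟨min (min h₁ (h₂ / 2)) 1, by positivity,
        (min_le_left _ _).trans (min_le_left _ _),
        ((min_le_left _ _).trans (min_le_right _ _)).trans_lt (half_lt_self hh₂), min_le_right _ _⟩
    have hin : ∀ t ∈ Icc (t₀ - h) t₀, ∀ y ∈ Metric.closedBall x₀ h,
        (t, y) ∈ Metric.closedBall (t₀, x₀) h := by
      intro t ht y hy
      rw [← closedBall_prod_same]
      refine ⟨?_, hy⟩
      rw [Real.closedBall_eq_Icc]
      exact ⟨ht.1, ht.2.trans (by linarith)⟩
    have hin₁ : ∀ t ∈ Icc (t₀ - h) t₀, ∀ y ∈ Metric.closedBall x₀ h,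
        (t, y) ∈ Metric.closedBall (t₀, x₀) h₁ := fun t ht y hy =>
      Metric.closedBall_subset_closedBall hhm.1 (hin t ht y hy)
    have hin₂ : ∀ t ∈ Icc (t₀ - h) t₀, ∀ y ∈ Metric.closedBall x₀ h,
        t ∈ Ioo 0 T ∧ 0 < coneWeight C R (t, y) := fun t ht y hy =>
      h₂s (t, y) (Metric.closedBall_subset_ball hhm.2.1 (hin t ht y hy))
    have hx₀h : x₀ ∈ Metric.closedBall x₀ h := Metric.mem_closedBall_self hh.le
    have ht₀h : t₀ ∈ Icc (t₀ - h) t₀ := ⟨by linarith, le_rfl⟩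
    refine no_positive_max (Ω := Ω) (u := relVel v l r) (F := F) (B := B₁) (C := c) (b := b)
      (b' := b') hx₀ hh
      (fun y hy => (hb _ (hin₁ t₀ ht₀h y hy)).1.continuousWithinAt)
      (fun y hy => (hb _ (hin₁ t₀ ht₀h y hy)).2.1)
      (fun y hy => (hb _ (hin₁ t₀ ht₀h y hy)).2.2.1)
      (fun t ht y hy hyΩ => hB₁ (t, y) ⟨Ioo_subset_Icc_self (hin₂ t ht y hy).1,
        Metric.closedBall_subset_closedBall hhm.2.2 hy, subset_closure hyΩ⟩)
      (fun t ht y hy => (hb _ (hin₁ t ht y hy)).2.2.2)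
      (hFc.mono fun p hp => ⟨Ioo_subset_Icc_self (hin₂ p.1 hp.1 p.2 hp.2.1).1, hp.2.2⟩) hF₀
      (fun t ht y hy hyc => hFle t ⟨(hin₂ t ht y hy).1.1.le, ht.2.trans ht₀.2⟩ y hyc)
      (fun t ht y hy hyΩ => ?_)
    obtain ⟨htT, hθ⟩ := hin₂ t ht y hy
    exact hsol.exists_hasFDerivAt_weightedEnstrophy hΩ.1 htT hyΩ
      (hB (t, y) ⟨⟨⟨htT.1.le, ht.2.trans ht₀.2⟩, subset_closure hyΩ⟩, hθ.le⟩)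
      (hC t (Ioo_subset_Icc_self htT) y hyΩ) hθ.le
  by_cases hxΩ : x₀ ∈ Ω
  · obtain ⟨h, hh, hhs⟩ := Metric.nhds_basis_closedBall.mem_iff.1 (hΩ.1.mem_nhds hxΩ)
    -- At an interior point no blow-up is needed: a constant barrier will do.
    refine ⟨h, hh, 0, fun _ => 1, fun _ => 0, fun p hp => ?_⟩
    rw [← closedBall_prod_same] at hp
    exact ⟨continuousAt_const, by simp [hhs hp.2], fun _ => hasFDerivAt_const _ _, by simp⟩
  · have hxf : x₀ ∈ frontier Ω := by
      rw [hΩ.1.frontier_eq]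
      exact ⟨hx₀, hxΩ⟩
    obtain ⟨U, ρ, hxU, hρ⟩ := hΩ.2 x₀ hxf
    obtain ⟨s, hs, hss⟩ := Metric.eventually_nhds_iff_ball.1
      (e1.and (hsol.flux_nonneg hl hr hinflow hρ ht₀I hxU hxf hζ₀))
    obtain ⟨s', hs', hs's, hs'1⟩ : ∃ s' > 0, s' ≤ s ∧ s' ≤ 1 :=
      ⟨min s 1, by positivity, min_le_left _ _, min_le_right _ _⟩
    have hprod : ∀ t ∈ Metric.ball t₀ s, ∀ y ∈ Metric.ball x₀ s', (t, y) ∈ Metric.ball (t₀, x₀) s :=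
      fun t ht y hy => by
        rw [← ball_prod_same]
        exact ⟨ht, Metric.ball_subset_ball hs's hy⟩
    have htT : ∀ t ∈ Metric.ball t₀ s, t ∈ Icc 0 T := fun t ht =>
      Ioo_subset_Icc_self (hss _ (hprod t ht x₀ (Metric.mem_ball_self hs'))).1
    have hmemc : ∀ t ∈ Metric.ball t₀ s, ∀ y ∈ Metric.ball x₀ s', y ∈ Ω →
        (t, y) ∈ Icc 0 T ×ˢ (Metric.closedBall x₀ 1 ∩ closure Ω) := fun t ht y hy hyΩ =>
      ⟨htT t ht, Metric.ball_subset_closedBall (Metric.ball_subset_ball hs'1 hy),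
        subset_closure hyΩ⟩
    obtain ⟨h₁, hh₁, c, hc⟩ := hρ.lower_bound hΩ.1 hxU hxf (I := Metric.ball t₀ s)
      (u := relVel v l r) (u' := fun t y => jac Ω v t y - crossCLM (r t)) (r := s')
      (B := max B₁ (B₂ + B₃)) hs'
      ((norm_nonneg _).trans ((hB₁ (t₀, x₀) ⟨Ioo_subset_Icc_self ht₀I,
        Metric.mem_closedBall_self zero_le_one, hx₀⟩).trans (le_max_left _ _)))
      (fun t ht => huc.comp (f := fun y : E3 => (t, y)) (by fun_prop) fun y hy => ⟨htT t ht, hy⟩)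
      (fun t ht y hy => hv.relVel_hasFDerivAt hΩ.1 (htT t ht) hy)
      (fun t ht y hy hyΩ => (hB₁ _ (hmemc t ht y hy hyΩ)).trans (le_max_left _ _))
      (fun t ht y hy hyΩ => (norm_sub_le _ _).trans ((add_le_add (hB₂ _ (hmemc t ht y hy hyΩ))
        ((norm_crossCLM_le _).trans (hB₃ t (htT t ht)))).trans (le_max_right _ _)))
      (fun t ht y hy hyf => (hss _ (hprod t ht y hy)).2 hyf)
    obtain ⟨h₂, hh₂, hUs⟩ := Metric.mem_nhds_iff.1 (hρ.isOpen.mem_nhds hxU)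
    obtain ⟨h, hh, hhs, hhh₁, hhh₂⟩ : ∃ h > 0, h < s ∧ h < h₁ ∧ h < h₂ := by
      obtain ⟨h, hh, hlt⟩ := exists_between (show 0 < min s (min h₁ h₂) by positivity)
      exact ⟨h, hh, by simpa using hlt⟩
    -- The sign change turns `u·∇ρ ≥ cρ` into the barrier inequality `u·∇b ≤ cb`.
    refine ⟨h, hh, c, fun y => -ρ y, fun y => -fderiv ℝ ρ y, fun p hp => ?_⟩
    rw [← closedBall_prod_same] at hp
    have hpU : p.2 ∈ U := hUs (Metric.closedBall_subset_ball hhh₂ hp.2)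
    have hd := hρ.differentiableAt hpU
    refine ⟨hd.continuousAt.neg, by simpa using hρ.mem_iff p.2 hpU,
      fun _ => hd.hasFDerivAt.neg, fun hpΩ => ?_⟩
    have := hc p.1 (Metric.closedBall_subset_ball hhs hp.1) p.2
      (Metric.closedBall_subset_ball hhh₁ hp.2) hpΩ
    simp only [neg_apply]
    linarith

end Solution

end UnderwaterVehicle

theorem proposition1
    (T : ℝ) (hT : 0 < T)
    -- the body `S` and the fluid domain `Ω = ℝ³ \ S`
    (S Ω : Set E3) (hS : IsCompact S) (hSconn : IsConnected S) (hΩS : Ω = Sᶜ)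
    (hΩ : UnderwaterVehicle.IsSmoothDomain Ω) (hΩconn : IsConnected Ω)
    -- the controls
    (m : ℕ) (χ : Fin m → E3 → ℝ) (hχ : ∀ j, ContDiffOn ℝ ∞ (χ j) (frontier Ω))
    (w : Fin m → ℝ → ℝ)
    -- the motion of the body, and the flow of the fluid
    (l r : ℝ → E3) (hl : ContinuousOn l (Icc 0 T)) (hr : ContinuousOn r (Icc 0 T))
    (v : ℝ → E3 → E3) (q : ℝ → E3 → ℝ)
    (hsol : UnderwaterVehicle.IsFluidSolution T Ω χ w l r v q)
    -- no vorticity initially, and none on the inflow part of the controlled boundary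
    (hinit : ∀ y ∈ Ω, UnderwaterVehicle.vorticity Ω v 0 y = 0)
    (hinflow : ∀ t ∈ Ioo 0 T, ∀ y ∈ ⋃ j, UnderwaterVehicle.bdrySupport Ω (χ j),
      ∑ j, w j t * χ j y ≤ 0 → UnderwaterVehicle.vorticity Ω v t y = 0) :
    ∀ t ∈ Icc 0 T, ∀ y ∈ Ω, UnderwaterVehicle.vorticity Ω v t y = 0 := by
  intro t ht y hy
  have hc : ContinuousOn (fun s => UnderwaterVehicle.vorticity Ω v s y) (Icc 0 T) :=
    hsol.regular.vorticity_continuousOn.comp (f := fun s : ℝ => (s, y)) (by fun_prop)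
      fun s hs => ⟨hs, subset_closure hy⟩
  -- The endpoints `0` and `T` are reached as limits of interior times.
  have hne : (𝓝[Ioo 0 T] t).NeBot := by
    rw [← mem_closure_iff_nhdsWithin_neBot, closure_Ioo hT.ne]
    exact ht
  refine tendsto_nhds_unique ((hc t ht).mono_left (nhdsWithin_mono _ Ioo_subset_Icc_self)) ?_
  refine tendsto_const_nhds.congr' ?_
  filter_upwards [self_mem_nhdsWithin] with s hs
  exact (hsol.vorticity_eq_zero_of_mem_Ioo hΩ hl hr hinit hinflow hs hy).symm
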